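/- **Setting.** Let $G=(V,E)$ be a finite directed acyclic graph and, for $v\in V$, let $(\mathcal X_v,\mu_v)$ be a measurable space with a $\sigma$-finite reference measure (counting measure for a discrete variable, in which case densities are probability mass functions). $G$ is a *generalized info-causal DAG* for a random vector $X=(X_v)_{v\in V}$ with distribution $P$ if $P$ has the density $P(x)=\prod_{k\in V}P(x_k\mid x_{pa(k)})$ with respect to $\prod_v\mu_v$, where $P(x_k\mid x_{pa(k)})\in[0,\infty]$ is a jointly measurable conditional density, given for all values of the parents and with $\int P(t\mid x_{pa(k)})\,\mu_k(dt)=1$. A *generalized info intervention* $\sigma(F)=\{\sigma_{jk}:(j,k)\in F\}$ consists of a set $F\subseteq V^2$ and measurable functions $\sigma_{jk}:\mathcal X_j\to\mathcal X_j$. Its intervention distribution has the density $$P(x\mid\sigma(F))=\prod_{k\in V}P(x_k\mid x^*_{pa(k)}),\qquad x^*_{jk}=\sigma_{jk}(x_j)\text{ if }(j,k)\in F,\quad x^*_{jk}=x_j\text{ otherwise } (j\in pa(k)).$$ For $S\subseteq V$, $P(x_S\mid\sigma(F))$ is obtained by integrating out the other variables, and for disjoint $S,T$, $P(x_S\mid\sigma(F),x_T)=P(x_S,x_T\mid\sigma(F))/P(x_T\mid\sigma(F))$,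 which is defined when $0<P(x_T\mid\sigma(F))<\infty$. Conditioning on $\sigma(F_1),\sigma(F_2)$ means that both interventions are applied. The *augmented DAG* $\bar G$ arises from $G$ by inserting an information node $N_{ij}$ in every edge $i\to j$, that is, replacing the edge by $i\to N_{ij}\to j$. The graph $\bar G^{\sigma(F)}$ arises from $\bar G$ by deleting the edges $i\to N_{ij}$ with $(i,j)\in F$ and $\sigma_{ij}$ constant. Let $N_F=\{N_{ij}:(i,j)\in F,\ i\to j\in E\}$. Write $\perp_d$ for d-separation, $anc(D)$ for the set of ancestors of nodes of $D$ (in $\bar G^{\sigma(F_1)}$ below), and $H_{\overline S}$ for the graph $H$ with all arrows into nodes of $S$ deleted. **Theorem.** Let $G=(V,E)$ be a generalized info-causal DAG, let $B,C,D\subseteq V$ be pairwise disjoint, and let $\sigma(F_1),\sigma(F_2)$ be generalized info interventions with $N_{F_1}\cap N_{F_2}=\emptyset$. Then the following hold at every point $x$ at which both sides of the equation are defined. *Rule 1 (insertion/deletion of observations).* If $B\perp_d C\mid D$ in $\bar G^{\sigma(F_1)}$, then $$P(x_B\mid\sigma(F_1),x_C,x_D)=P(x_B\mid\sigma(F_1),x_D).$$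 *Rule 3 (insertion/deletion of actions).* If $B\perp_d N_{F_2}\mid D$ in $\bar G^{\sigma(F_1)}_{\overline{N_{F_2}\setminus anc(D)}}$, then $$P(x_B\mid\sigma(F_1),\sigma(F_2),x_D)=P(x_B\mid\sigma(F_1),x_D).$$ -/

import Mathlib

open MeasureTheory
open scoped ENNReal

namespace GenInfo

/-! ### d-separation in a directed graph -/

/-- A list of nodes (the nodes of a path, in order) is active given `Z` in the directed graph with
arrows `R`: for any three consecutive nodes `u, w, v`, if `w` is a collider (`u → w ← v`), then `w`
is in `Z` or has a descendant in `Z`; if `w` is not a collider, then `w` is not in `Z`. -/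
def IsActive {W : Type*} (R : W → W → Prop) (Z : Set W) (l : List W) : Prop :=
  ∀ u w v : W, [u, w, v] <:+: l →
    ((R u w ∧ R v w) → ∃ z ∈ Z, Relation.ReflTransGen R w z) ∧
    (¬ (R u w ∧ R v w) → w ∉ Z)

/-- `A` and `B` are d-separated by `Z` in the directed graph with arrows `R`: no path (without
repeated nodes, arrows traversed in either direction) from `A` to `B` is active given `Z`. -/
def DSep {W : Type*} (R : W → W → Prop) (A B Z : Set W) : Prop :=
  ∀ a ∈ A, ∀ b ∈ B, ∀ p : (SimpleGraph.fromRel R).Walk a b,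
    p.IsPath → ¬ IsActive R Z p.support

/-- The strict ancestors of the nodes of `S`. -/
def anc {W : Type*} (R : W → W → Prop) (S : Set W) : Set W :=
  {w | ∃ s ∈ S, Relation.TransGen R w s}

/-- The graph obtained by deleting all arrows that point to nodes of `S`. -/
def removeInto {W : Type*} (R : W → W → Prop) (S : Set W) : W → W → Prop :=
  fun a b => R a b ∧ b ∉ S

/-! ### Generalized info interventions -/

/-- A generalized info intervention `σ(F) = {σ_jk : (j, k) ∈ F}`: an index set `F ⊆ V × V` and
measurable information functions `σ_jk : X_j → X_j`. (Only the `σ_jk` with `(j, k) ∈ F` are ever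
used.) -/
structure InfoIntervention {V : Type*} (X : V → Type*) [∀ v, MeasurableSpace (X v)] where
  /-- the information index set `F` -/
  F : Set (V × V)
  /-- the information functions -/
  fn : ∀ j _k : V, X j → X j
  measurable_fn : ∀ j k, Measurable (fn j k)

namespace InfoIntervention

variable {V : Type*} {X : V → Type*} [∀ v, MeasurableSpace (X v)]

open Classical in
/-- The information on `X_j` that `k` receives: `σ_jk(x_j)` if `(j, k) ∈ F`, and `x_j` otherwise. -/
noncomputable def transfer (σ : InfoIntervention X) (j k : V) (t : X j) : X j :=
  if (j, k) ∈ σ.F then σ.fn j k t else t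

/-- The edge `(j, k)` is cut by `σ(F)`: `(j, k) ∈ F` and `σ_jk` is a constant function. -/
def Cuts (σ : InfoIntervention X) (j k : V) : Prop :=
  (j, k) ∈ σ.F ∧ ∃ c : X j, ∀ t, σ.fn j k t = c

open Classical in
/-- The joint intervention `σ(F₁, F₂)`. -/
noncomputable def both (σ₁ σ₂ : InfoIntervention X) : InfoIntervention X where
  F := σ₁.F ∪ σ₂.F
  fn j k := if (j, k) ∈ σ₁.F then σ₁.fn j k else σ₂.fn j k
  measurable_fn j k := by
    split_ifs
    · exact σ₁.measurable_fn j k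
    · exact σ₂.measurable_fn j k

theorem measurable_transfer (σ : InfoIntervention X) (j k : V) :
    Measurable (σ.transfer j k) := by
  unfold transfer
  split_ifs
  · exact σ.measurable_fn j k
  · exact measurable_id

end InfoIntervention

/-! ### Augmented graphs -/

/-- Nodes of the augmented DAG: the nodes of `G`, and one information node `N_ij` for every edge
`i → j` of `G`. -/
abbrev AugNode {V : Type*} (E : V → V → Prop) : Type _ := V ⊕ {e : V × V // E e.1 e.2}

/-- The arrows of the intervention augmented DAG: `i → N_ij`, unless it is cut by `σ(F)`, and
`N_ij → j`, for all edges `i → j` of `G`. -/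
def augEdge {V : Type*} {X : V → Type*} [∀ v, MeasurableSpace (X v)] (E : V → V → Prop)
    (σ : InfoIntervention X) : AugNode E → AugNode E → Prop
  | .inl i, .inr e => e.1.1 = i ∧ ¬ σ.Cuts e.1.1 e.1.2
  | .inr e, .inl j => e.1.2 = j
  | .inl _, .inl _ => False
  | .inr _, .inr _ => False

/-- The set `N_F` of information nodes of `σ(F)`. -/
def infoNodes {V : Type*} {X : V → Type*} [∀ v, MeasurableSpace (X v)] (E : V → V → Prop)
    (σ : InfoIntervention X) : Set (AugNode E) :=
  {n | ∃ e : {e : V × V // E e.1 e.2}, e.1 ∈ σ.F ∧ n = .inr e}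

/-- A set of nodes of `G`, as a set of nodes of the augmented DAG. -/
def augSet {V : Type*} (E : V → V → Prop) (S : Finset V) : Set (AugNode E) :=
  Sum.inl '' (S : Set V)

/-! ### Generalized info-causal DAGs and their intervention distributions -/

/-- A generalized info-causal DAG for a random vector with distribution `P` on `∏ v, X v`, where
densities are taken with respect to reference measures `μ v` on the `X v` (counting measures in
the case of discrete variables): an acyclic set `E` of edges, and for each node `v` a (version of
the) conditional density `cond v x_v x_pa(v) = P(x_v | x_pa(v))`, such that `P(x)` is the product of
the `P(x_v | x_pa(v))`. That `cond v` is a version of the conditional density of `X_v` given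
`X_pa(v)` under `P` follows (`cond_mul_marg`). -/
structure InfoCausalDAG {V : Type*} [Fintype V] {X : V → Type*} [∀ v, MeasurableSpace (X v)]
    (μ : ∀ v, Measure (X v)) (P : Measure (∀ v, X v)) where
  /-- the edges: `E i j` means `i → j` -/
  E : V → V → Prop
  acyclic : ∀ v, ¬ Relation.TransGen E v v
  /-- the conditional densities `P(x_v | x_pa(v))` -/
  cond : ∀ v, X v → (∀ j : {j // E j v}, X j) → ℝ≥0∞
  measurable_cond : ∀ v, Measurable (Function.uncurry (cond v))
  lintegral_cond : ∀ v y, ∫⁻ t, cond v t y ∂(μ v) = 1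
  factorizes : P = (Measure.pi μ).withDensity (fun x => ∏ v, cond v (x v) (fun j => x j))

/-- The marginal density of the variables in `S`, at the point `x_S`, of a joint density `f` with
respect to the product of the `μ v`: all other variables are integrated out. -/
noncomputable def marg {V : Type*} [Fintype V] [DecidableEq V] {X : V → Type*}
    [∀ v, MeasurableSpace (X v)] (μ : ∀ v, Measure (X v)) (f : (∀ v, X v) → ℝ≥0∞) (S : Finset V)
    (x : ∀ v, X v) : ℝ≥0∞ :=
  lmarginal μ Sᶜ f x

/-- The conditional density `f(x_B | x_D) = f(x_B, x_D) / f(x_D)`. -/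
noncomputable def condDensity {V : Type*} [Fintype V] [DecidableEq V] {X : V → Type*}
    [∀ v, MeasurableSpace (X v)] (μ : ∀ v, Measure (X v)) (f : (∀ v, X v) → ℝ≥0∞)
    (B D : Finset V) (x : ∀ v, X v) : ℝ≥0∞ :=
  marg μ f (B ∪ D) x / marg μ f D x

namespace InfoCausalDAG

variable {V : Type*} [Fintype V] {X : V → Type*} [∀ v, MeasurableSpace (X v)]
  {μ : ∀ v, Measure (X v)} {P : Measure (∀ v, X v)}

/-- The observational density `P(x)`. -/
noncomputable def density (G : InfoCausalDAG μ P) (x : ∀ v, X v) : ℝ≥0∞ :=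
  ∏ v, G.cond v (x v) (fun j => x j)

/-- The density `P(x | σ(F))` of the generalized info-intervention distribution: every node `k`
keeps its mechanism `P(x_k | x_pa(k))`, but receives `σ_jk(x_j)` instead of `x_j` from each parent
`j` with `(j, k) ∈ F`. -/
noncomputable def intDensity (G : InfoCausalDAG μ P) (σ : InfoIntervention X) (x : ∀ v, X v) :
    ℝ≥0∞ :=
  ∏ k, G.cond k (x k) (fun j => σ.transfer j k (x j))

theorem measurable_factor (G : InfoCausalDAG μ P) (v : V) :
    Measurable (fun x : ∀ v, X v => G.cond v (x v) (fun j => x j)) :=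
  (G.measurable_cond v).comp ((measurable_pi_apply v).prodMk
    (measurable_pi_lambda _ fun j => measurable_pi_apply (j : V)))

theorem exists_no_child (G : InfoCausalDAG μ P) (T : Finset V) (hT : T.Nonempty) :
    ∃ v ∈ T, ∀ w ∈ T, ¬ G.E v w := by
  have hirr : Std.Irrefl (Relation.TransGen (Function.swap G.E)) :=
    ⟨fun v h => G.acyclic v (Relation.transGen_swap.1 h)⟩
  have hwf : WellFounded (Relation.TransGen (Function.swap G.E)) :=
    Finite.wellFounded_of_trans_of_irrefl _
  obtain ⟨v, hv, h⟩ := hwf.has_min (T : Set V) hT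
  exact ⟨v, hv, fun w hw hE => h w hw (Relation.TransGen.single hE)⟩

variable [DecidableEq V] [∀ v, SigmaFinite (μ v)]

/-- Integrating out a set `T ⊆ A` of nodes that has no children in `A \ T`. -/
theorem lmarginal_factors (G : InfoCausalDAG μ P) (T : Finset V) :
    ∀ A : Finset V, T ⊆ A → (∀ v ∈ T, ∀ w ∈ A, G.E v w → w ∈ T) →
    lmarginal μ T (fun x => ∏ v ∈ A, G.cond v (x v) (fun j => x j)) =
      fun x => ∏ v ∈ A \ T, G.cond v (x v) (fun j => x j) := by
  induction hn : T.card generalizing T with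
  | zero =>
    intro A _ _
    rw [Finset.card_eq_zero] at hn
    subst hn
    simp
  | succ n ih =>
    intro A hTA hch
    obtain ⟨v, hv, hvT⟩ := G.exists_no_child T (Finset.card_pos.1 (by omega))
    have hvA : ∀ w ∈ A, ¬ G.E v w := fun w hw hE => hvT w (hch v hv w hw hE) hE
    have hm : Measurable (fun x : ∀ v, X v => ∏ v ∈ A, G.cond v (x v) (fun j => x j)) :=
      Finset.measurable_fun_prod _ fun v _ => G.measurable_factor v
    rw [lmarginal_erase' _ hm hv]
    have hin : (fun x : ∀ v, X v => ∫⁻ t, ∏ u ∈ A,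
        G.cond u (Function.update x v t u) (fun j => Function.update x v t j) ∂μ v) =
        fun x => ∏ u ∈ A.erase v, G.cond u (x u) (fun j => x j) := by
      funext x
      have h1 : ∀ t, ∏ u ∈ A,
          G.cond u (Function.update x v t u) (fun j => Function.update x v t j) =
          G.cond v t (fun j => x j) * ∏ u ∈ A.erase v, G.cond u (x u) (fun j => x j) := by
        intro t
        rw [← Finset.mul_prod_erase A _ (hTA hv)]
        congr 1
        · rw [Function.update_self]
          congr 1
          funext j
          refine Function.update_of_ne (fun h => G.acyclic v (Relation.TransGen.single ?_)) _ _
          have := j.2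
          rwa [h] at this
        · refine Finset.prod_congr rfl fun u hu => ?_
          rw [Finset.mem_erase] at hu
          rw [Function.update_of_ne hu.1]
          congr 1
          funext j
          refine Function.update_of_ne (fun h => hvA u hu.2 ?_) _ _
          have := j.2
          rwa [h] at this
      simp_rw [h1]
      have h2 : Measurable (fun t => G.cond v t (fun j => x j)) :=
        (G.measurable_cond v).comp (measurable_id.prodMk measurable_const)
      rw [lintegral_mul_const _ h2, G.lintegral_cond, one_mul]
    rw [hin, ih (T.erase v) (by rw [Finset.card_erase_of_mem hv]; omega) (A.erase v)
      (Finset.erase_subset_erase v hTA) ?_]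
    · funext x
      refine Finset.prod_congr ?_ fun _ _ => rfl
      ext u
      simp only [Finset.mem_sdiff, Finset.mem_erase]
      grind
    · intro u hu w hw hE
      rw [Finset.mem_erase] at hu hw ⊢
      exact ⟨hw.1, hch u hu.2 w hw.2 hE⟩

open Classical in
/-- `cond v` is a version of the conditional density of `X_v` given `X_pa(v)`:
`P(x_v | x_pa(v)) P(x_pa(v)) = P(x_v, x_pa(v))`, for every point `x`. -/
theorem cond_mul_marg (G : InfoCausalDAG μ P) (v : V) (x : ∀ v, X v) :
    G.cond v (x v) (fun j => x j) * marg μ G.density (Finset.univ.filter fun j => G.E j v) x =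
      marg μ G.density (insert v (Finset.univ.filter fun j => G.E j v)) x := by
  set pa : Finset V := Finset.univ.filter fun j => G.E j v with hpa
  set T : Finset V := Finset.univ.filter fun j => Relation.TransGen G.E v j with hT
  have hvT : v ∉ T := by simpa [hT] using G.acyclic v
  have hpT : ∀ j ∈ pa, j ∉ insert v T := by
    intro j hj hjT
    simp only [hpa, hT, Finset.mem_filter, Finset.mem_univ, true_and, Finset.mem_insert] at hj hjT
    rcases hjT with rfl | h
    · exact G.acyclic _ (Relation.TransGen.single hj)
    · exact G.acyclic v (h.tail hj)
  have hm : Measurable G.density :=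
    Finset.measurable_fun_prod _ fun v _ => G.measurable_factor v
  set R : Finset V := (pa ∪ insert v T)ᶜ with hR
  have e1 : (insert v pa)ᶜ = R ∪ T := by
    ext j; have := hpT j; simp only [hR, Finset.mem_compl, Finset.mem_union, Finset.mem_insert]
    grind
  have e2 : paᶜ = R ∪ insert v T := by
    ext j; have := hpT j; simp only [hR, Finset.mem_compl, Finset.mem_union, Finset.mem_insert]
    grind
  have d1 : Disjoint R T := by
    rw [Finset.disjoint_left]; intro j; simp only [hR, Finset.mem_compl]; grind
  have d2 : Disjoint R (insert v T) := by
    rw [Finset.disjoint_left]; intro j; simp only [hR, Finset.mem_compl]; grind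
  have f1 := G.lmarginal_factors T Finset.univ (Finset.subset_univ _) (by
    intro u hu w _ hE
    simp only [hT, Finset.mem_filter, Finset.mem_univ, true_and] at hu ⊢
    exact hu.tail hE)
  have f2 := G.lmarginal_factors (insert v T) Finset.univ (Finset.subset_univ _) (by
    intro u hu w _ hE
    simp only [hT, Finset.mem_insert, Finset.mem_filter, Finset.mem_univ, true_and] at hu ⊢
    rcases hu with rfl | hu
    · exact Or.inr (Relation.TransGen.single hE)
    · exact Or.inr (hu.tail hE))
  unfold marg
  rw [e1, e2, lmarginal_union μ _ hm d1, lmarginal_union μ _ hm d2]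
  unfold density
  rw [f1, f2]
  have hs : Finset.univ \ T = insert v (Finset.univ \ insert v T) := by
    ext j; simp only [Finset.mem_sdiff, Finset.mem_insert, Finset.mem_univ]; grind
  rw [hs]
  simp_rw [Finset.prod_insert (show v ∉ Finset.univ \ insert v T by simp)]
  simp only [lmarginal]
  have hm2 : Measurable (fun x : ∀ v, X v =>
      ∏ u ∈ Finset.univ \ insert v T, G.cond u (x u) (fun j => x j)) :=
    Finset.measurable_fun_prod _ fun v _ => G.measurable_factor v
  have hm3 : Measurable (fun y : ∀ i : R, X i => ∏ u ∈ Finset.univ \ insert v T,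
      G.cond u (Function.updateFinset x R y u) (fun j => Function.updateFinset x R y j)) :=
    hm2.comp measurable_updateFinset
  rw [← lintegral_const_mul _ hm3]
  refine lintegral_congr fun y => ?_
  have hvR : v ∉ R := by simp [hR]
  have hu : ∀ j ∉ R, Function.updateFinset x R y j = x j := fun j hj => by
    simp [Function.updateFinset, hj]
  rw [hu v hvR]
  congr 2
  funext j
  exact (hu _ (by simp [hR, hpa, j.2])).symm

end InfoCausalDAG

end GenInfo

/-!
Both rules come from one pointwise factorization of marginal densities.

Every intervention density is the observational density of another causal DAG, whose edges are
those that are not cut (`InfoCausalDAG.intervene`). So the variables outside an ancestral set `A` of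
`B ∪ C ∪ D` integrate out to `1`, and marginals on subsets of `A` are integrals of the product of
the factors `P(x_k | x*_pa(k))` with `k ∈ A`. Let `A₁` be the set of nodes of `A \ D` that active
trails given `D` reach from `B`, in the graph of Rule 3. The central combinatorial fact
(`InfoCausalDAG.family_of_reached`) is that the family of `k ∈ A`, that is `k` with its uncut
parents, either avoids `A₁` or is contained in `A₁ ∪ D`, and that in the second case `σ₂` does not
change the factor of `k`. For this, two kinds of nodes `k` are distinguished. If `k` has a
descendant in `D`, a trail that arrives at `k` may turn back to the parents there. If not, then `k`
is an ancestor of `B`, and the reversed directed path from `B` reaches `k`; or it is an ancestor of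
`C`, which would continue the trail to `C`.

Hence the product over `A` splits as `g h`, where `g` depends on `A₁ ∪ D`, `h` does not depend on
`A₁`, and `g` is common to `σ₁` and `σ₁, σ₂` (`InfoCausalDAG.exists_factorization`). By Tonelli all
marginals in the two rules split accordingly, and as `B ⊆ A₁` and `C` is disjoint from `A₁`, the
equalities of the quotients follow after cross-multiplication.

d-separation is stated for paths without repeated nodes, while reachability (`Reach`) is about
trails, which may repeat nodes. The two agree because cutting a loop out of an active trail in an
acyclic graph leaves an active trail (`IsActive.cut_loop`): if the cut creates a new collider, then
the loop left that node along an arrow and, not being a directed cycle, met a collider below it.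
-/

namespace GenInfo

/-! ### Active trails and active paths -/

section Trails

variable {W : Type*} {R : W → W → Prop} {A Z : Set W}

theorem IsActive.of_infix {l l' : List W} (h : IsActive R Z l) (hl : l' <:+: l) :
    IsActive R Z l' :=
  fun u w v huv => h u w v (huv.trans hl)

theorem IsActive.reverse {l : List W} (h : IsActive R Z l) : IsActive R Z l.reverse := by
  intro u w v huv
  have h1 : [v, w, u] <:+: l := by simpa using List.reverse_infix.2 huv
  have h2 := h v w u h1
  exact ⟨fun hc => h2.1 hc.symm, fun hc => h2.2 fun hc' => hc hc'.symm⟩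

theorem infix_triple_append_cons {u m v w : W} {l₁ l₃ : List W}
    (h : [u, m, v] <:+: l₁ ++ w :: l₃) :
    [u, m, v] <:+: l₁ ++ [w] ∨ [u, m, v] <:+: w :: l₃ ∨
      (m = w ∧ (∃ s, l₁ = s ++ [u]) ∧ ∃ t, l₃ = v :: t) := by
  induction l₁ with
  | nil => exact Or.inr (Or.inl h)
  | cons x l₁ ih =>
    rw [List.cons_append, List.infix_cons_iff] at h
    rcases h with h | h
    · rw [List.cons_prefix_cons] at h
      obtain ⟨rfl, h⟩ := h
      match l₁, h with
      | [], h =>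
        rw [List.nil_append, List.cons_prefix_cons] at h
        obtain ⟨rfl, t, rfl⟩ := h
        exact Or.inr (Or.inr ⟨rfl, ⟨[], rfl⟩, t, rfl⟩)
      | [y], h =>
        simp only [List.cons_append, List.nil_append, List.cons_prefix_cons] at h
        obtain ⟨rfl, rfl, -⟩ := h
        exact Or.inl (List.infix_refl _)
      | y :: z :: l, h =>
        simp only [List.cons_append, List.cons_prefix_cons] at h
        obtain ⟨rfl, rfl, -⟩ := h
        exact Or.inl ⟨[], l ++ [w], by simp⟩
    · rcases ih h with h | h | ⟨rfl, ⟨s, rfl⟩, t⟩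
      · exact Or.inl (List.infix_cons h)
      · exact Or.inr (Or.inl h)
      · exact Or.inr (Or.inr ⟨rfl, ⟨x :: s, rfl⟩, t⟩)

/-- An active trail that leaves `x` along an arrow either meets a collider, which is then a
descendant of `x` with a descendant in `Z`, or is directed all the way to its end. -/
theorem exists_mem_or_transGen_of_isActive {e : W} (l : List W) :
    ∀ x : W, List.IsChain (SimpleGraph.fromRel R).Adj (x :: (l ++ [e])) →
      IsActive R Z (x :: (l ++ [e])) → (∀ y ∈ (l ++ [e]).head?, R x y) →
      (∃ z ∈ Z, Relation.ReflTransGen R x z) ∨ Relation.TransGen R x e := by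
  induction l with
  | nil => exact fun x _ _ hx => Or.inr (.single (hx e rfl))
  | cons y l ih =>
    intro x hc ha hx
    have hxy : R x y := hx y rfl
    obtain ⟨m, t, hm⟩ : ∃ m t, l ++ [e] = m :: t := by
      cases l <;> simp
    by_cases hmy : R m y
    · obtain ⟨z, hz, hyz⟩ := (ha x y m ⟨[], t, by simp [hm]⟩).1 ⟨hxy, hmy⟩
      exact Or.inl ⟨z, hz, hyz.head hxy⟩
    · have hym : R y m := by
        rw [List.cons_append, hm] at hc
        have := (List.isChain_cons_cons.1 (List.isChain_cons_cons.1 hc).2).1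
        rw [SimpleGraph.fromRel_adj] at this
        exact this.2.resolve_right hmy
      rcases ih y (List.isChain_cons_cons.1 hc).2 (ha.of_infix ⟨[x], [], by simp⟩)
        (by rw [hm]; rintro _ ⟨⟩; exact hym) with ⟨z, hz, h⟩ | h
      · exact Or.inl ⟨z, hz, h.head hxy⟩
      · exact Or.inr (h.head hxy)

/-- Cutting out a loop of an active trail leaves an active trail. -/
theorem IsActive.cut_loop (hR : ∀ v, ¬ Relation.TransGen R v v) {w : W} {l₁ l₂ l₃ : List W}
    (hc : List.IsChain (SimpleGraph.fromRel R).Adj (l₁ ++ w :: (l₂ ++ w :: l₃)))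
    (ha : IsActive R Z (l₁ ++ w :: (l₂ ++ w :: l₃))) : IsActive R Z (l₁ ++ w :: l₃) := by
  intro u m v h
  rcases infix_triple_append_cons h with h | h | ⟨rfl, ⟨s, rfl⟩, t, rfl⟩
  · exact ha u m v (h.trans ⟨[], l₂ ++ w :: l₃, by simp⟩)
  · exact ha u m v (h.trans ⟨l₁ ++ w :: l₂, [], by simp⟩)
  obtain ⟨y, r, hy⟩ : ∃ y r, l₂ ++ [m] = y :: r := by
    cases l₂ <;> simp
  have hloop : m :: (l₂ ++ [m]) <:+: s ++ [u] ++ m :: (l₂ ++ m :: v :: t) :=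
    ⟨s ++ [u], v :: t, by simp⟩
  have hfirst := ha u m y ⟨s, r ++ v :: t, by
    have : l₂ ++ m :: v :: t = (l₂ ++ [m]) ++ v :: t := by simp
    rw [this, hy]; simp⟩
  obtain ⟨r', y', hy'⟩ : ∃ r' y', m :: l₂ = r' ++ [y'] := by
    obtain ⟨r', y', h⟩ := List.eq_nil_or_concat (m :: l₂) |>.resolve_left (by simp)
    exact ⟨r', y', by simpa using h⟩
  have hlast := ha y' m v ⟨s ++ [u] ++ r', t, by
    have : s ++ [u] ++ m :: (l₂ ++ m :: v :: t) = s ++ [u] ++ (m :: l₂) ++ m :: v :: t := by simp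
    rw [this, hy']; simp⟩
  refine ⟨fun hcol => ?_, fun hncol => ?_⟩
  · by_cases hym : R y m
    · exact hfirst.1 ⟨hcol.1, hym⟩
    · have hmy : R m y := by
        have h2 := hc.infix hloop
        rw [hy] at h2
        have := (List.isChain_cons_cons.1 h2).1
        rw [SimpleGraph.fromRel_adj] at this
        exact this.2.resolve_right hym
      exact (exists_mem_or_transGen_of_isActive l₂ m (hc.infix hloop) (ha.of_infix hloop)
        (by rw [hy]; rintro _ ⟨⟩; exact hmy)).resolve_right (hR m)
  · by_cases hum : R u m
    · exact hlast.2 fun h => hncol ⟨hum, h.2⟩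
    · exact hfirst.2 fun h => hum h.1

theorem exists_eq_append_of_not_nodup {l : List W} (h : ¬ l.Nodup) :
    ∃ l₁ w l₂ l₃, l = l₁ ++ w :: (l₂ ++ w :: l₃) := by
  induction l with
  | nil => simp at h
  | cons x l ih =>
    by_cases hx : x ∈ l
    · obtain ⟨s, t, rfl⟩ := List.append_of_mem hx
      exact ⟨[], x, s, t, rfl⟩
    · obtain ⟨l₁, w, l₂, l₃, rfl⟩ := ih (by simpa [hx] using h)
      exact ⟨x :: l₁, w, l₂, l₃, rfl⟩

/-- In an acyclic graph, nodes joined by an active trail are joined by an active path. -/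
theorem exists_nodup_isActive (hR : ∀ v, ¬ Relation.TransGen R v v) {a b : W} (l : List W)
    (hc : List.IsChain (SimpleGraph.fromRel R).Adj l) (ha : IsActive R Z l)
    (hb : l.head? = some b) (hl : l.getLast? = some a) :
    ∃ l' : List W, List.IsChain (SimpleGraph.fromRel R).Adj l' ∧ IsActive R Z l' ∧
      l'.head? = some b ∧ l'.getLast? = some a ∧ l'.Nodup := by
  induction hn : l.length using Nat.strong_induction_on generalizing l with
  | _ n ih =>
    by_cases hd : l.Nodup
    · exact ⟨l, hc, ha, hb, hl, hd⟩
    obtain ⟨l₁, w, l₂, l₃, rfl⟩ := exists_eq_append_of_not_nodup hd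
    refine ih (l₁ ++ w :: l₃).length (by simp at hn ⊢; omega) (l₁ ++ w :: l₃) ?_
      (ha.cut_loop hR hc) ?_ ?_ rfl
    · rw [List.isChain_split] at hc ⊢
      refine ⟨hc.1, hc.2.infix ⟨w :: l₂, [], by simp⟩⟩
    · cases l₁ <;> simpa using hb
    · simpa [List.getLast?_append, List.getLast?_cons] using hl

variable (R A Z) in
/-- `Reach R A Z d v`: some trail from `A` to `v` is active given `Z`. Its last arrow points to `v`
if `d = false`; if `d = true`, it points away from `v`, or the trail consists of `v` alone. Trails
may repeat nodes, so that they can be extended step by step. -/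
inductive Reach : Bool → W → Prop
  | start {a : W} : a ∈ A → Reach true a
  | forward {d : Bool} {v w : W} : Reach d v → v ∉ Z → R v w → Reach false w
  | backward {v w : W} : Reach true v → v ∉ Z → R w v → Reach true w
  | collide {v w z : W} : Reach false v → z ∈ Z → Relation.ReflTransGen R v z → R w v →
      Reach true w

/-- The trail behind `Reach`, listed from its end `v` back to `A`. -/
theorem Reach.exists_trail (hR : ∀ v, ¬ Relation.TransGen R v v) {d : Bool} {v : W}
    (h : Reach R A Z d v) :
    ∃ l : List W, List.IsChain (SimpleGraph.fromRel R).Adj (v :: l) ∧ IsActive R Z (v :: l) ∧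
      (∃ a ∈ A, (v :: l).getLast? = some a) ∧ (∀ u ∈ l.head?, if d then R v u else R u v) := by
  have hasymm : ∀ {a b}, R a b → ¬ R b a := fun h h' => hR _ ((Relation.TransGen.single h).tail h')
  have hne : ∀ {a b}, R a b → a ≠ b := by
    rintro a _ h rfl; exact hR _ (.single h)
  -- it suffices to check the new triple, whose middle node is the old end
  have key : ∀ {v w : W} {l : List W}, (R v w ∨ R w v) →
      List.IsChain (SimpleGraph.fromRel R).Adj (v :: l) → IsActive R Z (v :: l) →
      (∃ a ∈ A, (v :: l).getLast? = some a) →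
      (∀ u ∈ l.head?, ((R w v ∧ R u v) → ∃ z ∈ Z, Relation.ReflTransGen R v z) ∧
        (¬ (R w v ∧ R u v) → v ∉ Z)) →
      List.IsChain (SimpleGraph.fromRel R).Adj (w :: v :: l) ∧ IsActive R Z (w :: v :: l) ∧
      (∃ a ∈ A, (w :: v :: l).getLast? = some a) := by
    intro v w l hvw hc ha hl hu
    refine ⟨List.isChain_cons_cons.2 ⟨?_, hc⟩, ?_, by simpa using hl⟩
    · rw [SimpleGraph.fromRel_adj]
      exact ⟨hvw.elim (fun h => (hne h).symm) hne, hvw.symm⟩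
    · intro x m y hxy
      rw [List.infix_cons_iff] at hxy
      rcases hxy with hxy | hxy
      · simp only [List.cons_prefix_cons] at hxy
        obtain ⟨rfl, rfl, t, rfl⟩ := hxy
        exact hu y rfl
      · exact ha x m y hxy
  induction h with
  | @start a ha =>
    exact ⟨[], by simp, fun u w v h => by simpa using h.length_le, ⟨a, ha, rfl⟩, by simp⟩
  | @forward d v w _ hv hvw ih =>
    obtain ⟨l, hc, ha, hl, hu⟩ := ih
    obtain ⟨h1, h2, h3⟩ := key (Or.inl hvw) hc ha hl
      fun u _ => ⟨fun h => absurd h.1 (hasymm hvw), fun _ => hv⟩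
    exact ⟨v :: l, h1, h2, h3, by simpa using hvw⟩
  | @backward v w _ hv hwv ih =>
    obtain ⟨l, hc, ha, hl, hu⟩ := ih
    obtain ⟨h1, h2, h3⟩ := key (Or.inr hwv) hc ha hl
      fun u hul => ⟨fun h => absurd h.2 (hasymm (by simpa using hu u hul)), fun _ => hv⟩
    exact ⟨v :: l, h1, h2, h3, by simpa using hwv⟩
  | @collide v w z _ hz hvz hwv ih =>
    obtain ⟨l, hc, ha, hl, hu⟩ := ih
    obtain ⟨h1, h2, h3⟩ := key (Or.inr hwv) hc ha hl
      fun u hul => ⟨fun _ => ⟨z, hz, hvz⟩, fun h => absurd ⟨hwv, by simpa using hu u hul⟩ h⟩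
    exact ⟨v :: l, h1, h2, h3, by simpa using hwv⟩

theorem DSep.not_reach (hR : ∀ v, ¬ Relation.TransGen R v v) {T : Set W} (h : DSep R A T Z)
    {d : Bool} {v : W} (hv : v ∈ T) : ¬ Reach R A Z d v := by
  intro hr
  obtain ⟨l, hc, ha, ⟨a, haA, hl⟩, -⟩ := hr.exists_trail hR
  obtain ⟨l', hc', ha', hb', hl', hnd⟩ := exists_nodup_isActive hR (v :: l) hc ha rfl hl
  have hne : l' ≠ [] := by rintro rfl; simp at hb'
  have e1 : l'.head hne = v := by
    rw [List.head?_eq_some_head hne] at hb'; simpa using hb'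
  have e2 : l'.getLast hne = a := by
    rw [List.getLast?_eq_some_getLast hne] at hl'; simpa using hl'
  subst e1 e2
  refine h _ haA _ hv (SimpleGraph.Walk.ofSupport l' hne hc').reverse ?_ ?_
  · rw [SimpleGraph.Walk.isPath_def]
    simpa using hnd
  · simpa using ha'.reverse

end Trails

/-! ### Marginals of products -/

section Marginals

variable {V : Type*} [DecidableEq V] {X : V → Type*} [∀ v, MeasurableSpace (X v)]
  {μ : ∀ v, Measure (X v)}

theorem lmarginal_eq_of_dependsOn {f : (∀ v, X v) → ℝ≥0∞} {s : Set V} (hf : DependsOn f s)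
    (T : Finset V) : DependsOn (lmarginal μ T f) s := by
  intro x y hxy
  refine lintegral_congr fun z => hf fun i hi => ?_
  by_cases hT : i ∈ T <;> simp [Function.updateFinset, hT, hxy i hi]

/-- Integrating a product of two factors over variables of which each occurs in one factor only. -/
theorem lmarginal_union_mul [∀ v, SigmaFinite (μ v)] {g h : (∀ v, X v) → ℝ≥0∞}
    (hg : Measurable g) (hh : Measurable h) {S T : Finset V} (hST : Disjoint S T) {s t : Set V}
    (hgs : DependsOn g s) (hht : DependsOn h t) (hT : ∀ v ∈ T, v ∉ s) (hS : ∀ v ∈ S, v ∉ t) :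
    lmarginal μ (S ∪ T) (fun x => g x * h x) = fun x => lmarginal μ S g x * lmarginal μ T h x := by
  rw [lmarginal_union μ (fun x => g x * h x) (hg.mul hh) hST]
  have h1 : lmarginal μ T (fun x => g x * h x) = fun x => g x * lmarginal μ T h x := by
    funext x
    simp only [lmarginal]
    rw [← lintegral_const_mul _ (f := fun y => h (Function.updateFinset x T y))
      (hh.comp measurable_updateFinset)]
    refine lintegral_congr fun y => ?_
    congr 1
    refine hgs fun i hi => ?_
    have : i ∉ T := fun h => hT i h hi
    simp [Function.updateFinset, this]
  rw [h1]
  funext x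
  have h2 : ∀ y, lmarginal μ T h (Function.updateFinset x S y) = lmarginal μ T h x := fun y =>
    lmarginal_eq_of_dependsOn hht T fun i hi => by
      have : i ∉ S := fun h => hS i h hi
      simp [Function.updateFinset, this]
  simp only [lmarginal] at h2 ⊢
  simp_rw [h2]
  rw [lintegral_mul_const _ (f := fun y => g (Function.updateFinset x S y))
    (hg.comp measurable_updateFinset)]

end Marginals

namespace InfoCausalDAG

variable {V : Type*} [Fintype V] {X : V → Type*} [∀ v, MeasurableSpace (X v)]
  {μ : ∀ v, Measure (X v)} {P : Measure (∀ v, X v)}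

/-! ### The intervened causal DAG -/

/-- The factor of the intervention density that belongs to `k`. -/
noncomputable def intFactor (G : InfoCausalDAG μ P) (σ : InfoIntervention X) (k : V)
    (x : ∀ v, X v) : ℝ≥0∞ :=
  G.cond k (x k) (fun j => σ.transfer j k (x j))

theorem measurable_intFactor (G : InfoCausalDAG μ P) (σ : InfoIntervention X) (k : V) :
    Measurable (G.intFactor σ k) :=
  (G.measurable_cond k).comp ((measurable_pi_apply k).prodMk
    (measurable_pi_lambda _ fun j =>
      (σ.measurable_transfer j k).comp (measurable_pi_apply (j : V))))

/-- The edges of `G` that are not cut by `σ(F)`. -/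
def uncut (G : InfoCausalDAG μ P) (σ : InfoIntervention X) (j k : V) : Prop :=
  G.E j k ∧ ¬ σ.Cuts j k

omit [Fintype V] in
theorem _root_.GenInfo.InfoIntervention.Cuts.transfer_eq {σ : InfoIntervention X} {j k : V}
    (h : σ.Cuts j k) (t : X j) : σ.transfer j k t = h.2.choose := by
  unfold InfoIntervention.transfer
  rw [if_pos h.1]
  exact h.2.choose_spec t

theorem dependsOn_intFactor (G : InfoCausalDAG μ P) (σ : InfoIntervention X) (k : V) :
    DependsOn (G.intFactor σ k) (insert k {j | G.uncut σ j k}) := by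
  intro x y hxy
  unfold intFactor
  rw [hxy k (Set.mem_insert _ _)]
  congr 1
  funext j
  by_cases hc : σ.Cuts j k
  · rw [hc.transfer_eq, hc.transfer_eq]
  · rw [hxy j (Set.mem_insert_of_mem _ ⟨j.2, hc⟩)]

open Classical in
/-- The values that `k` receives from its parents, in terms of the values of its uncut parents:
across a cut edge, it receives the constant value of the information function. -/
noncomputable def received (G : InfoCausalDAG μ P) (σ : InfoIntervention X) (k : V)
    (y : ∀ j : {j // G.uncut σ j k}, X j) (j : {j // G.E j k}) : X j :=
  if h : σ.Cuts j k then h.2.choose else σ.transfer j k (y ⟨j, j.2, h⟩)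

theorem measurable_received (G : InfoCausalDAG μ P) (σ : InfoIntervention X) (k : V) :
    Measurable (G.received σ k) := by
  refine measurable_pi_lambda _ fun j => ?_
  unfold received
  split_ifs with h
  · exact measurable_const
  · exact (σ.measurable_transfer j k).comp (measurable_pi_apply _)

theorem received_eq (G : InfoCausalDAG μ P) (σ : InfoIntervention X) (k : V) (x : ∀ v, X v) :
    G.received σ k (fun j => x j) = fun j : {j // G.E j k} => σ.transfer j k (x j) := by
  funext j
  unfold received
  split_ifs with h
  · exact (h.transfer_eq _).symm
  · rfl

/-- The intervention distribution of `σ(F)` as the observational distribution of a causal DAG, with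
the uncut edges as its edges. -/
noncomputable def intervene (G : InfoCausalDAG μ P) (σ : InfoIntervention X) :
    InfoCausalDAG μ ((Measure.pi μ).withDensity (G.intDensity σ)) where
  E := G.uncut σ
  acyclic v h := G.acyclic v (Relation.TransGen.mono (fun _ _ h => h.1) v v h)
  cond k t y := G.cond k t (G.received σ k y)
  measurable_cond k :=
    (G.measurable_cond k).comp
      (measurable_fst.prodMk ((G.measurable_received σ k).comp measurable_snd))
  lintegral_cond k y := G.lintegral_cond k _
  factorizes := by
    congr 1
    funext x
    exact Finset.prod_congr rfl fun k _ => congrArg (G.cond k (x k)) (G.received_eq σ k x).symm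

theorem intervene_cond (G : InfoCausalDAG μ P) (σ : InfoIntervention X) (k : V) (x : ∀ v, X v) :
    (G.intervene σ).cond k (x k) (fun j => x j) = G.intFactor σ k x :=
  congrArg (G.cond k (x k)) (G.received_eq σ k x)

variable [DecidableEq V] [∀ v, SigmaFinite (μ v)]

/-- The marginal density on a subset of an ancestral set `A` involves the factors of `A` only. -/
theorem marg_intDensity (G : InfoCausalDAG μ P) (σ : InfoIntervention X) {A S : Finset V}
    (hA : ∀ j k, G.uncut σ j k → k ∈ A → j ∈ A) (hS : S ⊆ A) :
    marg μ (G.intDensity σ) S =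
      lmarginal μ (A \ S) (fun x => ∏ k ∈ A, G.intFactor σ k x) := by
  have h := (G.intervene σ).lmarginal_factors Aᶜ Finset.univ (Finset.subset_univ _) (by
    intro v hv w _ hE
    rw [Finset.mem_compl] at hv ⊢
    exact fun hw => hv (hA v w hE hw))
  simp only [intervene_cond] at h
  have e : Sᶜ = (A \ S) ∪ Aᶜ := by
    ext v
    have := @hS v
    simp only [Finset.mem_compl, Finset.mem_union, Finset.mem_sdiff]
    tauto
  have hd : Disjoint (A \ S) Aᶜ := by
    rw [Finset.disjoint_left]; simp; tauto
  funext x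
  unfold marg
  have hm : Measurable (G.intDensity σ) :=
    Finset.measurable_fun_prod _ fun k _ => G.measurable_intFactor σ k
  rw [e, lmarginal_union μ _ hm hd]
  unfold intDensity
  have h' : lmarginal μ Aᶜ (fun x => ∏ k, G.cond k (x k) (fun j => σ.transfer j k (x j))) =
    fun x => ∏ k ∈ Finset.univ \ Aᶜ, G.intFactor σ k x := h
  rw [h']
  simp

/-- If every family (a node `k ∈ A` with its uncut parents) lies in `A₁ ∪ D` (for `k ∈ K`) or
avoids `A₁` (for `k ∉ K`), then a marginal density given on `D` splits into a factor for `A₁` and a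
factor for the rest of `A`. -/
theorem marg_intDensity_eq_mul (G : InfoCausalDAG μ P) (σ : InfoIntervention X)
    {A K A₁ D S : Finset V} (hA : ∀ j k, G.uncut σ j k → k ∈ A → j ∈ A) (hKA : K ⊆ A)
    (hA₁ : A₁ ⊆ A) (hDS : D ⊆ S) (hSA : S ⊆ A)
    (hK : ∀ k ∈ K, ∀ j, j = k ∨ G.uncut σ j k → j ∈ A₁ ∪ D)
    (hK' : ∀ k ∈ A \ K, ∀ j, j = k ∨ G.uncut σ j k → j ∉ A₁) (x : ∀ v, X v) :
    marg μ (G.intDensity σ) S x =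
      lmarginal μ (A₁ \ S) (fun x => ∏ k ∈ K, G.intFactor σ k x) x *
        lmarginal μ ((A \ A₁) \ S) (fun x => ∏ k ∈ A \ K, G.intFactor σ k x) x := by
  rw [G.marg_intDensity σ hA hSA]
  have e : A \ S = A₁ \ S ∪ (A \ A₁) \ S := by
    ext v
    have := @hA₁ v
    simp only [Finset.mem_union, Finset.mem_sdiff]
    tauto
  have e2 : (fun x => ∏ k ∈ A, G.intFactor σ k x) = fun x =>
      (∏ k ∈ K, G.intFactor σ k x) * ∏ k ∈ A \ K, G.intFactor σ k x := by
    funext x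
    rw [mul_comm, Finset.prod_sdiff hKA]
  have hdep : ∀ (L : Finset V) (s : Set V), (∀ k ∈ L, ∀ j, j = k ∨ G.uncut σ j k → j ∈ s) →
      DependsOn (fun x => ∏ k ∈ L, G.intFactor σ k x) s := fun L s hL y z hyz =>
    Finset.prod_congr rfl fun k hk =>
      G.dependsOn_intFactor σ k fun j hj => hyz j (hL k hk j hj)
  rw [e, e2, lmarginal_union_mul (s := ((A₁ ∪ D : Finset V) : Set V)) (t := {v | v ∉ A₁})
    (Finset.measurable_fun_prod _ fun k _ => G.measurable_intFactor σ k)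
    (Finset.measurable_fun_prod _ fun k _ => G.measurable_intFactor σ k) ?_
    (hdep _ _ fun k hk j hj => hK k hk j hj) (hdep _ _ fun k hk j hj => hK' k hk j hj)]
  · intro v hv
    have := @hDS v
    simp only [Finset.mem_sdiff, Finset.coe_union, Set.mem_union, Finset.mem_coe] at hv ⊢
    tauto
  · intro v hv
    simp only [Finset.mem_sdiff, Set.mem_ofPred_eq] at hv ⊢
    tauto
  · rw [Finset.disjoint_left]
    intro v
    simp only [Finset.mem_sdiff]
    tauto

end InfoCausalDAG

namespace InfoCausalDAG

variable {V : Type*} [Fintype V] {X : V → Type*} [∀ v, MeasurableSpace (X v)]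
  {μ : ∀ v, Measure (X v)} {P : Measure (∀ v, X v)}

/-! ### Trails in the augmented graph -/

theorem augEdge_acyclic (G : InfoCausalDAG μ P) (σ : InfoIntervention X) (n : AugNode G.E) :
    ¬ Relation.TransGen (augEdge G.E σ) n n := by
  have key : ∀ (i : V) (m : AugNode G.E), Relation.TransGen (augEdge G.E σ) (.inl i) m →
      (∀ j, m = .inl j → Relation.TransGen G.E i j) ∧
        ∀ e, m = .inr e → Relation.ReflTransGen G.E i e.1.1 := by
    intro i m h
    induction h with
    | @single m h =>
      rcases m with j | e
      · exact h.elim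
      · refine ⟨by simp, ?_⟩
        rintro _ ⟨⟩
        rw [h.1]
    | @tail m n _ h ih =>
      rcases m with j | e <;> rcases n with k | e'
      · exact h.elim
      · refine ⟨by simp, ?_⟩
        rintro _ ⟨⟩
        rw [h.1]
        exact (ih.1 j rfl).to_reflTransGen
      · refine ⟨?_, by simp⟩
        rintro _ ⟨⟩
        have h : e.1.2 = k := h
        exact Relation.TransGen.tail' (ih.2 e rfl) (h ▸ e.2)
      · exact h.elim
  have hV : ∀ i, ¬ Relation.TransGen (augEdge G.E σ) (.inl i) (.inl i) := fun i h =>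
    G.acyclic i ((key i _ h).1 i rfl)
  rcases n with i | e
  · exact hV i
  · intro h
    obtain ⟨m, hm, h'⟩ := Relation.TransGen.head'_iff.1 h
    rcases m with j | e'
    · exact hV j (Relation.TransGen.tail' h' hm)
    · exact hm.elim

/-- The arrows of the augmented graph for `σ₁`, without those into the information nodes of `σ₂`
that are not ancestors of `D`. -/
def ruleEdge (G : InfoCausalDAG μ P) (σ₁ σ₂ : InfoIntervention X) (D : Finset V) :
    AugNode G.E → AugNode G.E → Prop :=
  removeInto (augEdge G.E σ₁) (infoNodes G.E σ₂ \ anc (augEdge G.E σ₁) (augSet G.E D))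

theorem ruleEdge_acyclic (G : InfoCausalDAG μ P) (σ₁ σ₂ : InfoIntervention X) (D : Finset V)
    (n : AugNode G.E) : ¬ Relation.TransGen (G.ruleEdge σ₁ σ₂ D) n n := fun h =>
  G.augEdge_acyclic σ₁ n (Relation.TransGen.mono (fun _ _ h => h.1) n n h)

theorem reflTransGen_augEdge (G : InfoCausalDAG μ P) (σ : InfoIntervention X) {i j : V}
    (h : Relation.ReflTransGen (G.uncut σ) i j) :
    Relation.ReflTransGen (augEdge G.E σ) (.inl i) (.inl j) := by
  induction h with
  | refl => exact .refl
  | @tail j k _ h ih =>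
    have h1 : augEdge G.E σ (.inl j) (.inr ⟨(j, k), h.1⟩) := ⟨rfl, h.2⟩
    have h2 : augEdge G.E σ (.inr ⟨(j, k), h.1⟩) (.inl k) := rfl
    exact (ih.tail h1).tail h2

/-- Ancestors of `D` remain so in `ruleEdge`, since no arrow into an ancestor of `D` is deleted. -/
theorem reflTransGen_ruleEdge (G : InfoCausalDAG μ P) (σ₁ σ₂ : InfoIntervention X)
    {D : Finset V} {k d : V} (hd : d ∈ D) (h : Relation.ReflTransGen (G.uncut σ₁) k d) :
    Relation.ReflTransGen (G.ruleEdge σ₁ σ₂ D) (.inl k) (.inl d) := by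
  induction h using Relation.ReflTransGen.head_induction_on with
  | refl => exact .refl
  | @head j k h h' ih =>
    have h2 : augEdge G.E σ₁ (.inr ⟨(j, k), h.1⟩) (.inl k) := rfl
    have hanc : .inr ⟨(j, k), h.1⟩ ∈ anc (augEdge G.E σ₁) (augSet G.E D) :=
      ⟨.inl d, ⟨d, hd, rfl⟩, Relation.TransGen.head' h2 (G.reflTransGen_augEdge σ₁ h')⟩
    have h1 : augEdge G.E σ₁ (.inl j) (.inr ⟨(j, k), h.1⟩) := ⟨rfl, h.2⟩
    refine .head ⟨h1, fun hn => hn.2 hanc⟩ (.head ⟨h2, ?_⟩ ih)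
    rintro ⟨⟨e, -, he⟩, -⟩
    cases he

/-- `k` is an ancestor of a node of `S`, or in `S`, after the intervention `σ(F)`. -/
def IsAncestor (G : InfoCausalDAG μ P) (σ : InfoIntervention X) (S : Finset V) (k : V) : Prop :=
  ∃ s ∈ S, Relation.ReflTransGen (G.uncut σ) k s

section Reachability

variable (G : InfoCausalDAG μ P) (σ₁ σ₂ : InfoIntervention X) (B D : Finset V)

/-- `Reach` from `B` given `D` along the arrows `ruleEdge`. -/
abbrev RuleReach : Bool → AugNode G.E → Prop :=
  Reach (G.ruleEdge σ₁ σ₂ D) (augSet G.E B) (augSet G.E D)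

/-- The node `k` of `G` is not in `D`, and an active trail leads from `B` to it. -/
def Reached (k : V) : Prop :=
  k ∉ D ∧ ∃ d, G.RuleReach σ₁ σ₂ B D d (.inl k)

variable {G σ₁ σ₂ B D}

theorem inl_notMem_augSet {k : V} (h : k ∉ D) : (.inl k : AugNode G.E) ∉ augSet G.E D := by
  rintro ⟨_, h', ⟨⟩⟩
  exact h h'

theorem inr_notMem_augSet (e) : (.inr e : AugNode G.E) ∉ augSet G.E D := by
  rintro ⟨_, -, h⟩
  cases h

theorem ruleEdge_inr (e : {e : V × V // G.E e.1 e.2}) :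
    G.ruleEdge σ₁ σ₂ D (.inr e) (.inl e.1.2) := by
  refine ⟨rfl, ?_⟩
  rintro ⟨⟨e, -, he⟩, -⟩
  cases he

theorem ruleEdge_inl {j k : V} (h : G.uncut σ₁ j k)
    (hn : .inr ⟨(j, k), h.1⟩ ∉ infoNodes G.E σ₂) :
    G.ruleEdge σ₁ σ₂ D (.inl j) (.inr ⟨(j, k), h.1⟩) :=
  ⟨⟨rfl, h.2⟩, fun h' => hn h'.1⟩

/-- Ancestors of `B` that are not ancestors of `D` are reached from `B` against the arrows: an
information node of `σ₂` on the way would be reached as well. -/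
theorem reach_of_isAncestor (hN : ∀ d, ∀ n ∈ infoNodes G.E σ₂, ¬ G.RuleReach σ₁ σ₂ B D d n)
    {k : V} (hB : G.IsAncestor σ₁ B k) (hD : ¬ G.IsAncestor σ₁ D k) :
    G.RuleReach σ₁ σ₂ B D true (.inl k) := by
  obtain ⟨b, hb, h⟩ := hB
  induction h using Relation.ReflTransGen.head_induction_on with
  | refl => exact .start ⟨b, hb, rfl⟩
  | @head j k h _ ih =>
    have hk : ¬ G.IsAncestor σ₁ D k := fun ⟨d, hd, hkd⟩ => hD ⟨d, hd, hkd.head h⟩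
    have hkD : k ∉ D := fun hd => hk ⟨k, hd, .refl⟩
    have hn : G.RuleReach σ₁ σ₂ B D true (.inr ⟨(j, k), h.1⟩) :=
      .backward (ih hk) (inl_notMem_augSet hkD) (ruleEdge_inr ⟨(j, k), h.1⟩)
    exact .backward hn (inr_notMem_augSet _) (ruleEdge_inl h fun hm => hN _ _ hm hn)

/-- Without information nodes to avoid, a trail that arrives at an ancestor of `C` that is not an
ancestor of `D` can be continued along the arrows to `C`. -/
theorem exists_reach_of_isAncestor (hN : infoNodes G.E σ₂ = ∅) {C : Finset V} {k : V}
    (hC : G.IsAncestor σ₁ C k) (hD : ¬ G.IsAncestor σ₁ D k) {d : Bool}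
    (hk : G.RuleReach σ₁ σ₂ B D d (.inl k)) :
    ∃ c ∈ C, ∃ d, G.RuleReach σ₁ σ₂ B D d (.inl c) := by
  obtain ⟨c, hc, h⟩ := hC
  induction h using Relation.ReflTransGen.head_induction_on generalizing d with
  | refl => exact ⟨c, hc, d, hk⟩
  | @head j k h _ ih =>
    have hjD : j ∉ D := fun hd => hD ⟨j, hd, .refl⟩
    have hn : G.RuleReach σ₁ σ₂ B D false (.inr ⟨(j, k), h.1⟩) :=
      .forward hk (inl_notMem_augSet hjD) (ruleEdge_inl h (by simp [hN]))
    exact ih (fun ⟨d, hd, hkd⟩ => hD ⟨d, hd, hkd.head h⟩)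
      (.forward hn (inr_notMem_augSet _) (ruleEdge_inr _))

variable [DecidableEq V]

/-- The central step. If `k` lies in the ancestral set of `B ∪ C ∪ D` and its family (`k` and its
uncut parents) contains a node that is reached, then every node of the family is reached or in `D`,
and `σ₂` does not modify the mechanism of `k`. -/
theorem family_of_reached {C : Finset V} (hCN : C = ∅ ∨ infoNodes G.E σ₂ = ∅)
    (hC : ∀ d, ∀ c ∈ C, ¬ G.RuleReach σ₁ σ₂ B D d (.inl c))
    (hN : ∀ d, ∀ n ∈ infoNodes G.E σ₂, ¬ G.RuleReach σ₁ σ₂ B D d n)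
    {k : V} (hk : G.IsAncestor σ₁ (B ∪ C ∪ D) k)
    (hr : ∃ j, (j = k ∨ G.uncut σ₁ j k) ∧ G.Reached σ₁ σ₂ B D j) :
    (∀ j, j = k ∨ G.uncut σ₁ j k → G.Reached σ₁ σ₂ B D j ∨ j ∈ D) ∧
      ∀ j, G.E j k → (j, k) ∉ σ₂.F := by
  -- outside the ancestors of `D`, reached nodes of the ancestral set are reached against the arrows
  have up : ¬ G.IsAncestor σ₁ D k →
      ((infoNodes G.E σ₂).Nonempty ∨ ∃ d, G.RuleReach σ₁ σ₂ B D d (.inl k)) →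
      G.RuleReach σ₁ σ₂ B D true (.inl k) := by
    intro hD h
    obtain ⟨s, hs, hks⟩ := hk
    rw [Finset.mem_union, Finset.mem_union] at hs
    rcases hs with (hs | hs) | hs
    · exact reach_of_isAncestor hN ⟨s, hs, hks⟩ hD
    · rcases hCN with rfl | hCN
      · simp at hs
      · obtain ⟨d, h⟩ := h.resolve_left (by simp [hCN])
        obtain ⟨c, hc, d, hcd⟩ := exists_reach_of_isAncestor hCN ⟨s, hs, hks⟩ hD h
        exact (hC d c hc hcd).elim
    · exact (hD ⟨s, hs, hks⟩).elim
  have hkD : ¬ G.IsAncestor σ₁ D k → k ∉ D := fun h hd => h ⟨k, hd, .refl⟩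
  have h1 : (G.RuleReach σ₁ σ₂ B D true (.inl k) ∧ k ∉ D) ∨
      G.RuleReach σ₁ σ₂ B D false (.inl k) := by
    obtain ⟨j, rfl | hj, hjD, d, hd⟩ := hr
    · cases d
      · exact Or.inr hd
      · exact Or.inl ⟨hd, hjD⟩
    by_cases hm : .inr ⟨(j, k), hj.1⟩ ∈ infoNodes G.E σ₂
    · by_cases hD : G.IsAncestor σ₁ D k
      · -- the arrow from `j` into the information node is kept, and leads to a contradiction
        obtain ⟨s, hs, hks⟩ := hD
        have hanc : .inr ⟨(j, k), hj.1⟩ ∈ anc (augEdge G.E σ₁) (augSet G.E D) :=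
          ⟨.inl s, ⟨s, hs, rfl⟩, Relation.TransGen.head' (b := .inl k)
            (show augEdge G.E σ₁ (.inr ⟨(j, k), hj.1⟩) (.inl k) from rfl)
            (G.reflTransGen_augEdge σ₁ hks)⟩
        exact (hN _ _ hm (.forward hd (inl_notMem_augSet hjD)
          ⟨⟨rfl, hj.2⟩, fun h => h.2 hanc⟩)).elim
      · exact Or.inl ⟨up hD (Or.inl ⟨_, hm⟩), hkD hD⟩
    · exact Or.inr (.forward (.forward hd (inl_notMem_augSet hjD) (ruleEdge_inl hj hm))
        (inr_notMem_augSet _) (ruleEdge_inr _))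
  have h2 : ∀ j (hj : G.E j k), G.RuleReach σ₁ σ₂ B D true (.inr ⟨(j, k), hj⟩) := by
    intro j hj
    rcases h1 with ⟨h1, hkD⟩ | h1
    · exact .backward h1 (inl_notMem_augSet hkD) (ruleEdge_inr ⟨(j, k), hj⟩)
    by_cases hD : G.IsAncestor σ₁ D k
    · obtain ⟨s, hs, hks⟩ := hD
      exact .collide h1 ⟨s, hs, rfl⟩ (G.reflTransGen_ruleEdge σ₁ σ₂ hs hks)
        (ruleEdge_inr ⟨(j, k), hj⟩)
    · exact .backward (up hD (Or.inr ⟨_, h1⟩)) (inl_notMem_augSet (hkD hD))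
        (ruleEdge_inr ⟨(j, k), hj⟩)
  have h3 : ∀ j (hj : G.E j k), .inr ⟨(j, k), hj⟩ ∉ infoNodes G.E σ₂ := fun j hj hm =>
    hN _ _ hm (h2 j hj)
  refine ⟨?_, fun j hj hF => h3 j hj ⟨⟨(j, k), hj⟩, hF, rfl⟩⟩
  rintro j (rfl | hj)
  · by_cases hjD : j ∈ D
    · exact Or.inr hjD
    · exact Or.inl ⟨hjD, h1.elim (fun h => ⟨_, h.1⟩) fun h => ⟨_, h⟩⟩
  · by_cases hjD : j ∈ D
    · exact Or.inr hjD
    · exact Or.inl ⟨hjD, _, .backward (h2 j hj.1) (inr_notMem_augSet _)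
        (ruleEdge_inl hj (h3 j hj.1))⟩

end Reachability

end InfoCausalDAG

namespace InfoCausalDAG

/-! ### Separation implies factorization -/

section Factorization

variable {V : Type*} [Fintype V] [DecidableEq V] {X : V → Type*} [∀ v, MeasurableSpace (X v)]
  {μ : ∀ v, Measure (X v)} {P : Measure (∀ v, X v)}

omit [DecidableEq V] in
theorem uncut_of_uncut_both {G : InfoCausalDAG μ P} {σ₁ σ₂ : InfoIntervention X} {j k : V}
    (h : G.uncut (σ₁.both σ₂) j k) : G.uncut σ₁ j k := by
  refine ⟨h.1, fun ⟨hF, c, hc⟩ => h.2 ⟨Or.inl hF, c, fun t => ?_⟩⟩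
  simpa [InfoIntervention.both, hF] using hc t

omit [DecidableEq V] in
theorem intFactor_both (G : InfoCausalDAG μ P) (σ₁ σ₂ : InfoIntervention X) {k : V}
    (h : ∀ j, G.E j k → (j, k) ∉ σ₂.F) : G.intFactor (σ₁.both σ₂) k = G.intFactor σ₁ k := by
  funext x
  unfold intFactor
  congr 1
  funext j
  have := h j j.2
  by_cases hF : ((j : V), k) ∈ σ₁.F <;>
    simp [InfoIntervention.transfer, InfoIntervention.both, hF, this]

/-- The factorization behind both rules: a marginal density on `S ⊇ D` is a marginal of `g`, over
variables in `A₁`, times a marginal of `h`, over variables in `A₂`. Only `h` depends on whether `σ₂`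
is applied in addition to `σ₁`. -/
theorem exists_factorization [∀ v, SigmaFinite (μ v)] (G : InfoCausalDAG μ P)
    (σ₁ σ₂ : InfoIntervention X) {B C D : Finset V} (hBD : Disjoint B D)
    (hCN : C = ∅ ∨ infoNodes G.E σ₂ = ∅)
    (hC : ∀ d, ∀ c ∈ C, ¬ G.RuleReach σ₁ σ₂ B D d (.inl c))
    (hN : ∀ d, ∀ n ∈ infoNodes G.E σ₂, ¬ G.RuleReach σ₁ σ₂ B D d n) :
    ∃ (A₁ A₂ : Finset V) (g : (∀ v, X v) → ℝ≥0∞), B ⊆ A₁ ∧ Disjoint A₁ C ∧ Disjoint A₁ A₂ ∧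
      ∀ σ, σ = σ₁ ∨ σ = σ₁.both σ₂ → ∃ h : (∀ v, X v) → ℝ≥0∞,
        ∀ S, D ⊆ S → S ⊆ B ∪ C ∪ D → ∀ x, marg μ (G.intDensity σ) S x =
          lmarginal μ (A₁ \ S) g x * lmarginal μ (A₂ \ S) h x := by
  classical
  set A : Finset V := Finset.univ.filter (G.IsAncestor σ₁ (B ∪ C ∪ D)) with hA
  set A₁ : Finset V := A.filter (G.Reached σ₁ σ₂ B D) with hA₁
  set K : Finset V :=
    A.filter fun k => ∃ j, (j = k ∨ G.uncut σ₁ j k) ∧ G.Reached σ₁ σ₂ B D j with hK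
  have hsub : B ∪ C ∪ D ⊆ A := fun v hv =>
    Finset.mem_filter.2 ⟨Finset.mem_univ v, v, hv, .refl⟩
  have hanc : ∀ j k, G.uncut σ₁ j k → k ∈ A → j ∈ A := by
    intro j k hjk hk
    simp only [hA, Finset.mem_filter, Finset.mem_univ, true_and] at hk ⊢
    obtain ⟨s, hs, hks⟩ := hk
    exact ⟨s, hs, hks.head hjk⟩
  have hfam : ∀ k ∈ K, (∀ j, j = k ∨ G.uncut σ₁ j k → G.Reached σ₁ σ₂ B D j ∨ j ∈ D) ∧
      ∀ j, G.E j k → (j, k) ∉ σ₂.F := fun k hk => by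
    rw [hK, Finset.mem_filter, hA, Finset.mem_filter] at hk
    exact family_of_reached hCN hC hN hk.1.2 hk.2
  refine ⟨A₁, A \ A₁, fun x => ∏ k ∈ K, G.intFactor σ₁ k x, ?_, ?_, Finset.disjoint_sdiff, ?_⟩
  · intro b hb
    refine Finset.mem_filter.2 ⟨hsub (by simp [hb]), Finset.disjoint_left.1 hBD hb, true, ?_⟩
    exact .start ⟨b, hb, rfl⟩
  · rw [Finset.disjoint_left]
    intro c hc hcC
    obtain ⟨-, -, d, hd⟩ := Finset.mem_filter.1 hc
    exact hC d c hcC hd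
  intro σ hσ
  have hcut : ∀ {j k}, G.uncut σ j k → G.uncut σ₁ j k := by
    rcases hσ with rfl | rfl
    · exact id
    · exact uncut_of_uncut_both
  have hg : (fun x => ∏ k ∈ K, G.intFactor σ k x) = fun x => ∏ k ∈ K, G.intFactor σ₁ k x := by
    rcases hσ with rfl | rfl
    · rfl
    · funext x
      exact Finset.prod_congr rfl fun k hk => by rw [G.intFactor_both σ₁ σ₂ (hfam k hk).2]
  refine ⟨fun x => ∏ k ∈ A \ K, G.intFactor σ k x, fun S hDS hS x => ?_⟩
  rw [G.marg_intDensity_eq_mul σ (K := K) (A₁ := A₁) (fun j k h => hanc j k (hcut h))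
    (Finset.filter_subset (fun _ => _) A) (Finset.filter_subset (fun _ => _) A) hDS
    (hS.trans hsub) ?_ ?_ x, hg]
  · intro k hk j hj
    have hj' : j = k ∨ G.uncut σ₁ j k := hj.imp id hcut
    have hjA : j ∈ A := by
      have hkA := (Finset.mem_filter.1 hk).1
      rcases hj' with rfl | hj'
      · exact hkA
      · exact hanc j k hj' hkA
    rw [Finset.mem_union]
    exact ((hfam k hk).1 j hj').imp (fun h => Finset.mem_filter.2 ⟨hjA, h⟩) id
  · intro k hk j hj hjA
    rw [Finset.mem_sdiff] at hk
    exact hk.2 (Finset.mem_filter.2 ⟨hk.1, j, hj.imp id hcut, (Finset.mem_filter.1 hjA).2⟩)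

end Factorization

end InfoCausalDAG

end GenInfo

/-! ### Insertion and deletion of observations and of actions -/

theorem mainTheorem6 {V : Type*} [Fintype V] [DecidableEq V] {X : V → Type*}
    [∀ v, MeasurableSpace (X v)] (μ : ∀ v, Measure (X v)) [∀ v, SigmaFinite (μ v)]
    (P : Measure (∀ v, X v)) (G : GenInfo.InfoCausalDAG μ P)
    (σ₁ σ₂ : GenInfo.InfoIntervention X)
    (hσ : Disjoint (GenInfo.infoNodes G.E σ₁) (GenInfo.infoNodes G.E σ₂))
    (B C D : Finset V) (hBC : Disjoint B C) (hBD : Disjoint B D) (hCD : Disjoint C D) :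
    -- Rule 1
    (GenInfo.DSep (GenInfo.augEdge G.E σ₁)
        (GenInfo.augSet G.E B) (GenInfo.augSet G.E C) (GenInfo.augSet G.E D) →
      ∀ x : ∀ v, X v,
        GenInfo.marg μ (G.intDensity σ₁) (C ∪ D) x ∈ Set.Ioo 0 ⊤ →
        GenInfo.marg μ (G.intDensity σ₁) D x ∈ Set.Ioo 0 ⊤ →
        GenInfo.condDensity μ (G.intDensity σ₁) B (C ∪ D) x =
          GenInfo.condDensity μ (G.intDensity σ₁) B D x) ∧
    -- Rule 3
    (GenInfo.DSep
        (GenInfo.removeInto (GenInfo.augEdge G.E σ₁)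
          (GenInfo.infoNodes G.E σ₂ \ GenInfo.anc (GenInfo.augEdge G.E σ₁) (GenInfo.augSet G.E D)))
        (GenInfo.augSet G.E B) (GenInfo.infoNodes G.E σ₂) (GenInfo.augSet G.E D) →
      ∀ x : ∀ v, X v,
        GenInfo.marg μ (G.intDensity (σ₁.both σ₂)) D x ∈ Set.Ioo 0 ⊤ →
        GenInfo.marg μ (G.intDensity σ₁) D x ∈ Set.Ioo 0 ⊤ →
        GenInfo.condDensity μ (G.intDensity (σ₁.both σ₂)) B D x =
          GenInfo.condDensity μ (G.intDensity σ₁) B D x) := by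
  refine ⟨fun hsep x h1 h2 => ?_, fun hsep x h1 h2 => ?_⟩
  · -- the intervention with empty index set has no information nodes to be avoided
    let τ : GenInfo.InfoIntervention X := ⟨∅, fun _ _ t => t, fun _ _ => measurable_id⟩
    have hτ : GenInfo.infoNodes G.E τ = ∅ := by
      ext n; simp [GenInfo.infoNodes, τ]
    have hedge : G.ruleEdge σ₁ τ D = GenInfo.augEdge G.E σ₁ := by
      funext a b
      simp [GenInfo.InfoCausalDAG.ruleEdge, GenInfo.removeInto, hτ]
    rw [← hedge] at hsep
    obtain ⟨A₁, A₂, g, hBA, hAC, hA, H⟩ := G.exists_factorization σ₁ τ (C := C) hBD (Or.inr hτ)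
      (fun d c hc => hsep.not_reach (G.ruleEdge_acyclic σ₁ τ D) ⟨c, hc, rfl⟩) (by simp [hτ])
    obtain ⟨h, hh⟩ := H σ₁ (Or.inl rfl)
    have hBA₂ : Disjoint A₂ B := (hA.mono_left hBA).symm
    rw [GenInfo.condDensity, GenInfo.condDensity,
      ENNReal.div_eq_div_iff h2.1.ne' h2.2.ne h1.1.ne' h1.2.ne,
      hh (B ∪ (C ∪ D)) (by grind) (by grind), hh (B ∪ D) (by grind) (by grind),
      hh (C ∪ D) (by grind) (by grind), hh D (by grind) (by grind)]
    -- `g` does not involve `C`, and `h` does not involve `B`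
    have e1 : A₁ \ (B ∪ (C ∪ D)) = A₁ \ (B ∪ D) := by
      ext v; have := Finset.disjoint_left.1 hAC; grind
    have e2 : A₁ \ (C ∪ D) = A₁ \ D := by
      ext v; have := Finset.disjoint_left.1 hAC; grind
    have e3 : A₂ \ (B ∪ (C ∪ D)) = A₂ \ (C ∪ D) := by
      ext v; have := Finset.disjoint_left.1 hBA₂; grind
    have e4 : A₂ \ (B ∪ D) = A₂ \ D := by
      ext v; have := Finset.disjoint_left.1 hBA₂; grind
    rw [e1, e2, e3, e4]
    ring
  · obtain ⟨A₁, A₂, g, hBA, -, hA, H⟩ := G.exists_factorization σ₁ σ₂ (C := ∅) hBD (Or.inl rfl)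
      (by simp) (fun d n hn => hsep.not_reach (G.ruleEdge_acyclic σ₁ σ₂ D) hn)
    obtain ⟨h, hh⟩ := H σ₁ (Or.inl rfl)
    obtain ⟨h', hh'⟩ := H (σ₁.both σ₂) (Or.inr rfl)
    have hBA₂ : Disjoint A₂ B := (hA.mono_left hBA).symm
    rw [GenInfo.condDensity, GenInfo.condDensity,
      ENNReal.div_eq_div_iff h2.1.ne' h2.2.ne h1.1.ne' h1.2.ne,
      hh' (B ∪ D) (by grind) (by grind), hh (B ∪ D) (by grind) (by grind),
      hh D (by grind) (by grind), hh' D (by grind) (by grind)]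
    have e : A₂ \ (B ∪ D) = A₂ \ D := by
      ext v; have := Finset.disjoint_left.1 hBA₂; grind
    rw [e]
    ring
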